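/- Let $\mathbb{Q}$ be the real quaternions, with $\mathbb{C}=\mathbb{R}+\mathbb{R}\mathbf{i}\subset\mathbb{Q}$, and let $\mathbb{DQ}=\{q_s+q_d\epsilon : q_s,q_d\in\mathbb{Q}\}$ be the dual quaternions, where $\epsilon\ne 0$, $\epsilon^2=0$ and $\epsilon$ commutes with all quaternions. A standard eigenvalue of $A\in\mathbb{Q}^{n\times n}$ is a complex number $\lambda$ with nonnegative imaginary part such that $A\mathbf{x}=\mathbf{x}\lambda$ for some nonzero $\mathbf{x}\in\mathbb{Q}^n$. For $\lambda\in\mathbb{C}$ let $J_r(\lambda)\in\mathbb{Q}^{r\times r}$ be the Jordan block with $\lambda$ on the diagonal, $1$ on the superdiagonal and $0$ elsewhere. **Theorem (Jordan-like form).** Let $\hat{A}=A_s+A_d\epsilon\in\mathbb{DQ}^{n\times n}$ with $A_s,A_d\in\mathbb{Q}^{n\times n}$, and let $\lambda_{1s},\dots,\lambda_{ms}\in\mathbb{C}$ be the distinct standard eigenvalues of $A_s$. Let an invertible matrix $P_s\in\mathbb{Q}^{n\times n}$ bring $A_s$ to Jordan form, $$P_s^{-1}A_sP_s=\mathrm{diag}(J_1,\dots,J_m),\qquad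 J_i=\mathrm{diag}\bigl(J_{n_{i1}}(\lambda_{is}),\dots,J_{n_{it_i}}(\lambda_{is})\bigr)\in\mathbb{Q}^{n_i\times n_i},$$ where $n_{ik}\ge 1$, $\sum_{k=1}^{t_i}n_{ik}=n_i$ and $\sum_{i=1}^m n_i=n$. Then there exist a matrix $P_d\in\mathbb{Q}^{n\times n}$ and matrices $H_i\in\mathbb{Q}^{n_i\times n_i}$ $(1\le i\le m)$ such that $\hat{P}=P_s+P_d\epsilon\in\mathbb{DQ}^{n\times n}$ is invertible and $$\hat{P}^{-1}\hat{A}\hat{P}=\mathrm{diag}(J_1+H_1\epsilon,\;J_2+H_2\epsilon,\;\dots,\;J_m+H_m\epsilon).$$ -/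

import Mathlib

open scoped Quaternion

/-- `μ` is a right eigenvalue of the quaternion matrix `A`: `A x = x μ` for some nonzero
quaternion vector `x`. -/
def IsRightEigenvalue {n : ℕ} (A : Matrix (Fin n) (Fin n) ℍ[ℝ]) (μ : ℍ[ℝ]) : Prop :=
  ∃ x : Fin n → ℍ[ℝ], x ≠ 0 ∧ A.mulVec x = fun i => x i * μ

/-- A standard eigenvalue is a right eigenvalue that is a complex number with nonnegative
imaginary part; `ℂ` sits in the quaternions as `ℝ + ℝ i`. -/
def IsStandardEigenvalue {n : ℕ} (A : Matrix (Fin n) (Fin n) ℍ[ℝ]) (μ : ℂ) : Prop :=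
  0 ≤ μ.im ∧ IsRightEigenvalue A (μ : ℍ[ℝ])

/-- The block diagonal matrix `diag(M 0, …, M (m-1))` of size `n = d 0 + ⋯ + d (m-1)`, the blocks being
placed along the diagonal in the given order. -/
def diagBlocks {R : Type*} [Zero R] {m n : ℕ} {d : Fin m → ℕ} (h : ∑ i, d i = n)
    (M : ∀ i, Matrix (Fin (d i)) (Fin (d i)) R) : Matrix (Fin n) (Fin n) R :=
  Matrix.reindex (finSigmaFinEquiv.trans (finCongr h)) (finSigmaFinEquiv.trans (finCongr h))
    (Matrix.blockDiagonal' M)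

/-- The `s × s` Jordan block with `μ` on the diagonal and `1` on the superdiagonal. -/
noncomputable def jordanBlock (s : ℕ) (μ : ℂ) : Matrix (Fin s) (Fin s) ℍ[ℝ] :=
  Matrix.of fun i j => if i = j then (μ : ℍ[ℝ]) else if (i : ℕ) + 1 = (j : ℕ) then 1 else 0

/-- The matrix `diag(J_{s 0}(μ), …, J_{s (t-1)}(μ))` of size `N = s 0 + ⋯ + s (t-1)`. -/
noncomputable def jordanGroup {t N : ℕ} {s : Fin t → ℕ} (h : ∑ k, s k = N) (μ : ℂ) :
    Matrix (Fin N) (Fin N) ℍ[ℝ] :=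
  diagBlocks h fun k => jordanBlock (s k) μ

/-- The dual quaternion matrix `S + D ε` with standard part `S` and dual part `D`.
Dual quaternions are the dual numbers over the quaternions (`ε² = 0`, `ε` central), and
`TrivSqZeroExt.inr q` is `q ε`. -/
noncomputable def dualMatrix {n : ℕ} (S D : Matrix (Fin n) (Fin n) ℍ[ℝ]) :
    Matrix (Fin n) (Fin n) (DualNumber ℍ[ℝ]) :=
  Matrix.of fun i j => TrivSqZeroExt.inl (S i j) + TrivSqZeroExt.inr (D i j)

/-! Write J for the Jordan form and M for `P_s⁻¹ A_d P_s`. Conjugating by `P_s (1 + X ε)` turns the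
dual part into `M + J X - X J`, so it suffices to cancel the off-diagonal blocks, that is, to solve
a Sylvester equation for each pair of distinct eigenvalues (`exists_sylvester`). The operator `X ↦
J_i X - X J_j` is real linear on a finite-dimensional space, and it is injective because J_i and J_j
are annihilated by coprime polynomials. These polynomials have real coefficients, which are central
in the quaternions. -/

open Polynomial in
/-- Two square matrices annihilated by coprime polynomials have no nonzero intertwiner. -/
theorem intertwiner_eq_zero {K R : Type*} [Field K] [Ring R] [Algebra K R]
    {p q : ℕ} {B : Matrix (Fin p) (Fin p) R} {C : Matrix (Fin q) (Fin q) R} {f g : K[X]}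
    (hfg : IsCoprime f g) (hB : aeval B f = 0) (hC : aeval C g = 0)
    {X : Matrix (Fin p) (Fin q) R} (hX : B * X = X * C) : X = 0 := by
  have key : ∀ h : K[X], aeval B h * X = X * aeval C h := by
    intro h
    induction h using Polynomial.induction_on' with
    | add u v hu hv => simp only [map_add, Matrix.add_mul, Matrix.mul_add, hu, hv]
    | monomial k a =>
      have hpow : B ^ k * X = X * C ^ k := by
        induction k with
        | zero => simp
        | succ k ih => rw [pow_succ, Matrix.mul_assoc, hX, ← Matrix.mul_assoc, ih,
            Matrix.mul_assoc, ← pow_succ]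
      simp only [aeval_monomial, ← Algebra.smul_def, Matrix.smul_mul, Matrix.mul_smul, hpow]
  obtain ⟨u, v, huv⟩ := hfg
  -- `u * f` kills `B`, but acts as the identity on `C` since it equals `1 - v * g`.
  have h1 := key (u * f)
  rw [map_mul, hB, mul_zero, Matrix.zero_mul] at h1
  have h2 : aeval C (u * f) = 1 := by
    have := congrArg (aeval C) huv
    rwa [map_add, map_mul _ v, hC, mul_zero, add_zero, map_one] at this
  rw [h2, Matrix.mul_one] at h1
  exact h1.symm

open Polynomial in
/-- The Sylvester equation is solvable when the coefficients are annihilated by coprime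
polynomials. -/
theorem exists_sylvester {K R : Type*} [Field K] [Ring R] [Algebra K R] [FiniteDimensional K R]
    {p q : ℕ} {B : Matrix (Fin p) (Fin p) R} {C : Matrix (Fin q) (Fin q) R} {f g : K[X]}
    (hfg : IsCoprime f g) (hB : aeval B f = 0) (hC : aeval C g = 0)
    (M : Matrix (Fin p) (Fin q) R) : ∃ X : Matrix (Fin p) (Fin q) R, B * X - X * C = M := by
  let T : Matrix (Fin p) (Fin q) R →ₗ[K] Matrix (Fin p) (Fin q) R :=
    { toFun := fun X => B * X - X * C
      map_add' := fun X Y => by rw [Matrix.mul_add, Matrix.add_mul]; abel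
      map_smul' := fun c X => by
        rw [Matrix.mul_smul, Matrix.smul_mul, ← smul_sub, RingHom.id_apply] }
  have hinj : Function.Injective T := by
    rw [injective_iff_map_eq_zero]
    exact fun X hX => intertwiner_eq_zero hfg hB hC (sub_eq_zero.mp hX)
  exact LinearMap.injective_iff_surjective.mp hinj M

/-- The real quadratic polynomial with roots `μ` and its complex conjugate. -/
noncomputable def conjQuadratic (μ : ℂ) : Polynomial ℝ :=
  (Polynomial.X - Polynomial.C μ.re) ^ 2 + Polynomial.C (μ.im ^ 2)

/-- The sign condition picks one root from each conjugate pair; conjugate numbers share the same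
quadratic. -/
theorem isCoprime_conjQuadratic {μ ν : ℂ} (hμ : 0 ≤ μ.im) (hν : 0 ≤ ν.im) (h : μ ≠ ν) :
    IsCoprime (conjQuadratic μ) (conjQuadratic ν) := by
  rw [Polynomial.isCoprime_iff_aeval_ne_zero_of_isAlgClosed ℝ ℂ]
  intro z
  by_contra! hz
  have root : ∀ w : ℂ, Polynomial.aeval z (conjQuadratic w) = 0 →
      z.re = w.re ∧ z.im ^ 2 = w.im ^ 2 := by
    intro w hw
    have hw' : (z - w.re) ^ 2 + (w.im : ℂ) ^ 2 = 0 := by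
      simpa [conjQuadratic] using hw
    have hfac : (z - w.re - w.im * Complex.I) * (z - w.re + w.im * Complex.I) = 0 := by
      linear_combination hw' - (w.im : ℂ) ^ 2 * Complex.I_sq
    rcases mul_eq_zero.mp hfac with h0 | h0
    all_goals
      have hre := congrArg Complex.re h0
      have him := congrArg Complex.im h0
      simp at hre him
      refine ⟨by linarith, ?_⟩
    · rw [show z.im = w.im by linarith]
    · rw [show z.im = -w.im by linarith]; ring
  obtain ⟨h1, h2⟩ := root μ hz.1
  obtain ⟨h3, h4⟩ := root ν hz.2
  refine h (Complex.ext (h1.symm.trans h3) ?_)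
  exact (sq_eq_sq₀ hμ hν).mp (h2.symm.trans h4)

/-- The nilpotent Jordan block. -/
def shiftMatrix (R : Type*) [Zero R] [One R] (s : ℕ) : Matrix (Fin s) (Fin s) R :=
  Matrix.of fun i j => if (i : ℕ) + 1 = (j : ℕ) then 1 else 0

theorem shiftMatrix_pow_apply {R : Type*} [Semiring R] {s : ℕ} (k : ℕ) (i j : Fin s)
    (h : (j : ℕ) < i + k) : (shiftMatrix R s ^ k) i j = 0 := by
  induction k generalizing i with
  | zero =>
    rw [pow_zero, Matrix.one_apply_ne]
    rintro rfl
    simp at h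
  | succ k ih =>
    rw [pow_succ', Matrix.mul_apply]
    refine Finset.sum_eq_zero fun l _ => ?_
    by_cases hl : (i : ℕ) + 1 = l
    · rw [ih l (by omega), mul_zero]
    · simp [shiftMatrix, hl]

theorem shiftMatrix_pow_self {R : Type*} [Semiring R] (s : ℕ) : shiftMatrix R s ^ s = 0 := by
  ext i j : 2
  exact shiftMatrix_pow_apply s i j (by omega)

theorem jordanBlock_eq_add (s : ℕ) (μ : ℂ) :
    jordanBlock s μ = Matrix.diagonal (fun _ => (μ : ℍ[ℝ])) + shiftMatrix ℍ[ℝ] s := by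
  ext1 i j
  by_cases h : i = j
  · subst h; simp [jordanBlock, shiftMatrix]
  · simp [jordanBlock, shiftMatrix, h]

theorem commute_diagonal_shiftMatrix {R : Type*} [Semiring R] (s : ℕ) (a : R) :
    Commute (Matrix.diagonal fun _ => a) (shiftMatrix R s) := by
  ext1 i j
  simp [shiftMatrix]

theorem Quaternion.coeComplex_sub_re_sq (μ : ℂ) :
    ((μ : ℍ[ℝ]) - algebraMap ℝ ℍ[ℝ] μ.re) ^ 2 + algebraMap ℝ ℍ[ℝ] (μ.im ^ 2) = 0 := by
  have h : (μ - algebraMap ℝ ℂ μ.re) ^ 2 + algebraMap ℝ ℂ (μ.im ^ 2) = 0 := by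
    apply Complex.ext <;> simp [pow_two]
  have := congrArg Quaternion.ofComplex h
  rwa [map_add, map_pow, map_sub, AlgHom.commutes, AlgHom.commutes, map_zero,
    Quaternion.coe_ofComplex] at this

/-- The scalar diagonal part is a root of the quadratic, so its value at the block is a multiple of
the nilpotent part by a commuting factor. -/
theorem aeval_jordanBlock_pow (s : ℕ) (μ : ℂ) :
    Polynomial.aeval (jordanBlock s μ) (conjQuadratic μ ^ s) = 0 := by
  set D : Matrix (Fin s) (Fin s) ℍ[ℝ] := Matrix.diagonal fun _ => (μ : ℍ[ℝ]) with hD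
  set S := shiftMatrix ℍ[ℝ] s
  set c := algebraMap ℝ (Matrix (Fin s) (Fin s) ℍ[ℝ]) μ.re
  have hDS : Commute D S := commute_diagonal_shiftMatrix s _
  have hcS : Commute c S := Algebra.commutes _ _
  have hcD : Commute c D := Algebra.commutes _ _
  have hquad : (D - c) ^ 2 + algebraMap ℝ _ (μ.im ^ 2) = 0 := by
    have hdiag : ∀ r : ℝ, algebraMap ℝ (Matrix (Fin s) (Fin s) ℍ[ℝ]) r =
        Matrix.diagonal fun _ => algebraMap ℝ ℍ[ℝ] r := fun r => by
      rw [Matrix.algebraMap_eq_diagonal]; rfl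
    simp only [c, hD, hdiag, Matrix.diagonal_sub, Matrix.diagonal_pow, Matrix.diagonal_add]
    rw [← Matrix.diagonal_zero]
    congr 1
    funext i
    exact Quaternion.coeComplex_sub_re_sq μ
  have hfac : Polynomial.aeval (jordanBlock s μ) (conjQuadratic μ) =
      S * (S + (D - c) + (D - c)) := by
    have hS : Commute (D - c) S := hDS.sub_left hcS
    have : Polynomial.aeval (jordanBlock s μ) (conjQuadratic μ) =
        ((D - c) + S) ^ 2 + algebraMap ℝ _ (μ.im ^ 2) := by
      rw [conjQuadratic, jordanBlock_eq_add]
      simp only [map_add, map_sub, map_pow, Polynomial.aeval_X, Polynomial.aeval_C]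
      rw [add_sub_right_comm]
    rw [this, hS.add_sq, add_assoc, add_assoc, add_comm, add_assoc, add_assoc,
      add_comm _ ((D - c) ^ 2), hquad, add_zero, mul_assoc, hS.eq, two_mul, pow_two]
    noncomm_ring
  have hcomm : Commute S (S + (D - c) + (D - c)) := by
    have : Commute S (D - c) := (hDS.sub_left hcS).symm
    exact ((Commute.refl S).add_right this).add_right this
  rw [map_pow, hfac, hcomm.mul_pow, shiftMatrix_pow_self, zero_mul]

/-- `diagBlocks` as an algebra homomorphism. -/
def diagBlocksAlgHom {R : Type*} [Ring R] [Algebra ℝ R] {m n : ℕ} {d : Fin m → ℕ}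
    (h : ∑ i, d i = n) :
    (∀ i, Matrix (Fin (d i)) (Fin (d i)) R) →ₐ[ℝ] Matrix (Fin n) (Fin n) R :=
  (Matrix.reindexAlgEquiv ℝ R (finSigmaFinEquiv.trans (finCongr h))).toAlgHom.comp
    { Matrix.blockDiagonal'RingHom (fun i => Fin (d i)) R with
      commutes' := fun r => by
        change Matrix.blockDiagonal' _ = _
        rw [Algebra.algebraMap_eq_smul_one, Matrix.blockDiagonal'_smul, Matrix.blockDiagonal'_one,
          Algebra.algebraMap_eq_smul_one] }

theorem diagBlocksAlgHom_apply {R : Type*} [Ring R] [Algebra ℝ R] {m n : ℕ} {d : Fin m → ℕ}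
    (h : ∑ i, d i = n) (M : ∀ i, Matrix (Fin (d i)) (Fin (d i)) R) :
    diagBlocksAlgHom h M = diagBlocks h M := rfl

theorem aeval_jordanGroup_pow {t N : ℕ} {s : Fin t → ℕ} (h : ∑ k, s k = N) (μ : ℂ) :
    Polynomial.aeval (jordanGroup h μ) (conjQuadratic μ ^ N) = 0 := by
  rw [jordanGroup, ← diagBlocksAlgHom_apply, Polynomial.aeval_algHom_apply]
  refine (congrArg _ (funext fun k => ?_)).trans (map_zero (diagBlocksAlgHom h))
  -- The exponent `N` bounds every block size, so one power annihilates all blocks.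
  have hk : s k ≤ N := h ▸ Finset.single_le_sum (fun _ _ => Nat.zero_le _) (Finset.mem_univ k)
  obtain ⟨r, rfl⟩ := Nat.exists_eq_add_of_le hk
  rw [Polynomial.aeval_pi_apply]
  change Polynomial.aeval (jordanBlock (s k) μ) _ = 0
  rw [pow_add, map_mul, aeval_jordanBlock_pow, zero_mul]

/-- If the Sylvester equations of distinct diagonal blocks are solvable, every matrix is block
diagonal up to a commutator with the block diagonal matrix. -/
theorem exists_add_commutator_eq_diagBlocks {R : Type*} [Ring R] {m n : ℕ} {d : Fin m → ℕ}
    (h : ∑ i, d i = n) (J : ∀ i, Matrix (Fin (d i)) (Fin (d i)) R)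
    (hJ : ∀ i j, i ≠ j → ∀ M : Matrix (Fin (d i)) (Fin (d j)) R,
      ∃ X : Matrix (Fin (d i)) (Fin (d j)) R, J i * X - X * J j = M)
    (M : Matrix (Fin n) (Fin n) R) :
    ∃ (X : Matrix (Fin n) (Fin n) R) (H : ∀ i, Matrix (Fin (d i)) (Fin (d i)) R),
      M + diagBlocks h J * X - X * diagBlocks h J = diagBlocks h H := by
  set e := finSigmaFinEquiv.trans (finCongr h)
  let M' := Matrix.reindex e.symm e.symm M
  -- With `i ≠ j` inside the existential, `choose` yields blocks for all pairs. The diagonal ones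
  -- are unconstrained, so `H` keeps their commutator with `J i`.
  have hsol : ∀ i j, ∃ X : Matrix (Fin (d i)) (Fin (d j)) R, i ≠ j →
      J i * X - X * J j = -Matrix.of fun a b => M' ⟨i, a⟩ ⟨j, b⟩ := by
    intro i j
    by_cases hij : i = j
    · exact ⟨0, fun hne => absurd hij hne⟩
    · obtain ⟨X, hX⟩ := hJ i j hij (-Matrix.of fun a b => M' ⟨i, a⟩ ⟨j, b⟩)
      exact ⟨X, fun _ => hX⟩
  choose Y hY using hsol
  let X' : Matrix (Σ i, Fin (d i)) (Σ i, Fin (d i)) R := Matrix.of fun p q => Y p.1 q.1 p.2 q.2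
  let H : ∀ i, Matrix (Fin (d i)) (Fin (d i)) R := fun i =>
    (Matrix.of fun a b => M' ⟨i, a⟩ ⟨i, b⟩) + J i * Y i i - Y i i * J i
  have hleft : ∀ i j a b, (Matrix.blockDiagonal' J * X') ⟨i, a⟩ ⟨j, b⟩ = (J i * Y i j) a b := by
    intro i j a b
    rw [Matrix.mul_apply, Fintype.sum_sigma, Finset.sum_eq_single i, Matrix.mul_apply]
    · simp [X']
    · intro k _ hk
      exact Finset.sum_eq_zero fun c _ => by
        rw [Matrix.blockDiagonal'_apply_ne _ _ _ hk.symm, zero_mul]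
    · simp
  have hright : ∀ i j a b, (X' * Matrix.blockDiagonal' J) ⟨i, a⟩ ⟨j, b⟩ = (Y i j * J j) a b := by
    intro i j a b
    rw [Matrix.mul_apply, Fintype.sum_sigma, Finset.sum_eq_single j, Matrix.mul_apply]
    · simp [X']
    · intro k _ hk
      exact Finset.sum_eq_zero fun c _ => by
        rw [Matrix.blockDiagonal'_apply_ne _ _ _ hk, mul_zero]
    · simp
  have hsigma : M' + Matrix.blockDiagonal' J * X' - X' * Matrix.blockDiagonal' J =
      Matrix.blockDiagonal' H := by
    ext1 ⟨i, a⟩ ⟨j, b⟩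
    rw [Matrix.sub_apply, Matrix.add_apply, hleft, hright]
    by_cases hij : i = j
    · subst hij
      simp [H]
    · rw [Matrix.blockDiagonal'_apply_ne _ _ _ hij, add_sub_assoc, ← Matrix.sub_apply, hY i j hij]
      simp
  refine ⟨Matrix.reindex e e X', H, ?_⟩
  have hM : M = Matrix.reindex e e M' := by ext1 i j; simp [M']
  unfold diagBlocks
  rw [hM, ← hsigma]
  simp only [Matrix.reindex_apply, Matrix.submatrix_mul_equiv, Matrix.submatrix_add,
    Matrix.submatrix_sub, e]
  rfl

theorem dualMatrix_mul {n : ℕ} (A B C D : Matrix (Fin n) (Fin n) ℍ[ℝ]) :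
    dualMatrix A B * dualMatrix C D = dualMatrix (A * C) (A * D + B * C) := by
  ext1 i j
  apply TrivSqZeroExt.ext
  · simp [dualMatrix, Matrix.mul_apply, TrivSqZeroExt.fst_sum]
  · simp [dualMatrix, Matrix.mul_apply, TrivSqZeroExt.snd_sum, Finset.sum_add_distrib]

theorem dualMatrix_one_zero {n : ℕ} : dualMatrix (1 : Matrix (Fin n) (Fin n) ℍ[ℝ]) 0 = 1 := by
  ext1 i j
  by_cases h : i = j
  · subst h; simp [dualMatrix]
  · simp [dualMatrix, h]

theorem diagBlocks_dualMatrix {m n : ℕ} {d : Fin m → ℕ} (h : ∑ i, d i = n)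
    (S D : ∀ i, Matrix (Fin (d i)) (Fin (d i)) ℍ[ℝ]) :
    diagBlocks h (fun i => dualMatrix (S i) (D i)) =
      dualMatrix (diagBlocks h S) (diagBlocks h D) := by
  ext1 i j
  simp only [diagBlocks, dualMatrix, Matrix.reindex_apply, Matrix.submatrix_apply, Matrix.of_apply,
    Matrix.blockDiagonal'_apply]
  split_ifs <;> simp

/-- A dual quaternion matrix with invertible standard part, as a unit. -/
noncomputable def dualMatrixUnit {n : ℕ} (S : (Matrix (Fin n) (Fin n) ℍ[ℝ])ˣ)
    (D : Matrix (Fin n) (Fin n) ℍ[ℝ]) : (Matrix (Fin n) (Fin n) (DualNumber ℍ[ℝ]))ˣ where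
  val := dualMatrix S.val D
  inv := dualMatrix S⁻¹.val (-(S⁻¹.val * D * S⁻¹.val))
  val_inv := by
    rw [dualMatrix_mul, ← dualMatrix_one_zero, S.mul_inv, mul_neg, mul_assoc,
      S.mul_inv_cancel_left, neg_add_cancel]
  inv_val := by
    rw [dualMatrix_mul, ← dualMatrix_one_zero, S.inv_mul, neg_mul, S.inv_mul_cancel_right,
      add_neg_cancel]

theorem theorem3p2 {n : ℕ} (A_s A_d : Matrix (Fin n) (Fin n) ℍ[ℝ])
    -- the distinct standard eigenvalues of `A_s`
    {m : ℕ} (ev : Fin m → ℂ) (ev_injective : Function.Injective ev)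
    (range_ev : Set.range ev = {μ : ℂ | IsStandardEigenvalue A_s μ})
    -- a Jordan form of `A_s`: block sizes `s i k`, group sizes `N i`, transition matrix `P_s`
    (N : Fin m → ℕ) (sum_N : ∑ i, N i = n)
    (t : Fin m → ℕ) (s : ∀ i, Fin (t i) → ℕ) (s_pos : ∀ i k, 0 < s i k)
    (sum_s : ∀ i, ∑ k, s i k = N i)
    (P_s : (Matrix (Fin n) (Fin n) ℍ[ℝ])ˣ)
    (jordan_form : P_s⁻¹.val * A_s * P_s.val =
      diagBlocks sum_N fun i => jordanGroup (sum_s i) (ev i)) :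
    ∃ (P_d : Matrix (Fin n) (Fin n) ℍ[ℝ]) (P : (Matrix (Fin n) (Fin n) (DualNumber ℍ[ℝ]))ˣ)
      (H : ∀ i, Matrix (Fin (N i)) (Fin (N i)) ℍ[ℝ]),
      P.val = dualMatrix P_s.val P_d ∧
      P⁻¹.val * dualMatrix A_s A_d * P.val =
        diagBlocks sum_N fun i => dualMatrix (jordanGroup (sum_s i) (ev i)) (H i) := by
  have hev : ∀ i, 0 ≤ (ev i).im := fun i =>
    (range_ev.subset (Set.mem_range_self i) : IsStandardEigenvalue A_s (ev i)).1
  obtain ⟨X, H, hXH⟩ := exists_add_commutator_eq_diagBlocks sum_N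
    (fun i => jordanGroup (sum_s i) (ev i))
    (fun i j hij => exists_sylvester
      ((isCoprime_conjQuadratic (hev i) (hev j) (ev_injective.ne hij)).pow (m := N i) (n := N j))
      (aeval_jordanGroup_pow (sum_s i) (ev i)) (aeval_jordanGroup_pow (sum_s j) (ev j)))
    (P_s⁻¹.val * A_d * P_s.val)
  -- This is `P_s (1 + X ε)`.
  refine ⟨P_s.val * X, dualMatrixUnit P_s (P_s.val * X), H, rfl, ?_⟩
  rw [diagBlocks_dualMatrix, ← hXH, ← jordan_form]
  change dualMatrix _ _ * dualMatrix _ _ * dualMatrix _ _ = _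
  rw [dualMatrix_mul, dualMatrix_mul]
  congr 1
  rw [P_s.inv_mul_cancel_left]
  noncomm_ring
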